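/- Let $\Sigma_{\mathrm{in}},\Sigma_{\mathrm{out}}$ be disjoint finite alphabets. A transducer $T=(Q,I,F,\Delta,f)$ consists of a finite set $Q$ of states, sets $I,F\subseteq Q$ of initial and final states, a finite set $\Delta\subseteq Q\times\Sigma_{\mathrm{in}}^*\times\Sigma_{\mathrm{out}}^*\times Q$ of transitions and a final output function $f:F\to\Sigma_{\mathrm{out}}^*$; it is real-time if $\Delta\subseteq Q\times\Sigma_{\mathrm{in}}\times\Sigma_{\mathrm{out}}^*\times Q$. An accepting run is a sequence of consecutive transitions from a state in $I$ to a state $q\in F$; if their labels are $(u_1,v_1),\dots,(u_r,v_r)$, the run has input $u_1\cdots u_r$ and accepts the word $u_1v_1\cdots u_rv_rf(q)\in(\Sigma_{\mathrm{in}}\cup\Sigma_{\mathrm{out}})^*$. The input and output of a word over $\Sigma_{\mathrm{in}}\cup\Sigma_{\mathrm{out}}$ are its projections to $\Sigma_{\mathrm{in}}^*$ and $\Sigma_{\mathrm{out}}^*$; two words are equivalent if they have the same input and the same output. We write $T_1\subseteq T_2$ if every (input, output) pair of a word accepted by $T_1$ is the pair of some word accepted by $T_2$. $T$ is $m$-ambiguous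 if every $u\in\Sigma_{\mathrm{in}}^*$ is the input of at most $m$ accepting runs. The delay $\mathrm{del}(u,v)$ of $u,v\in\Sigma_{\mathrm{out}}^*$ is the reduced word of $v^{-1}u$ in the free group on $\Sigma_{\mathrm{out}}$. For words $w=s_0a_1s_1\cdots a_ns_n$ and $w'=t_0a_1t_1\cdots a_nt_n$ with $a_i\in\Sigma_{\mathrm{in}}$ and $s_i,t_i\in\Sigma_{\mathrm{out}}^*$, let $\mathrm{lag}(w,w')=\max_{0\le j\le n}|\mathrm{del}(s_0\cdots s_j,\,t_0\cdots t_j)|$. We write $T_1\subseteq_k T_2$ if every word $w$ accepted by $T_1$ has an equivalent word $w'$ accepted by $T_2$ with $\mathrm{lag}(w,w')\le k$. **Theorem.** Let $T_i=(Q_i,I_i,F_i,\Delta_i,f_i)$, $i=1,2$, be real-time transducers over the same alphabets such that $T_1\subseteq T_2$ and $T_2$ is $m$-ambiguous, $m\in\mathbb N$. Let $M$ be the maximal length of an output word $v$ that occurs on a transition $(q,u,v,q')\in\Delta_1\cup\Delta_2$ or as a final output $f_i(q)$ with $q\in F_i$ ($M=0$ if there are none). Then $T_1\subseteq_k T_2$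 for $$k=4M\,|Q_1|\left((|\Delta_2|\,|Q_2|)^m\,2^{|Q_2||\Delta_2|}+1\right).$$ -/

import Mathlib

/-- A transition `src --inp|out--> tgt` of a transducer with input alphabet `A`, output alphabet
`B` and state set `Q`. -/
structure Transition (A B Q : Type*) where
  src : Q
  inp : List A
  out : List B
  tgt : Q

/-- A finite transducer `(Q, I, F, Δ, f)`: `I, F ⊆ Q`, a finite set
`Δ ⊆ Q × A* × B* × Q` of transitions, and a final output function `f : F → B*`. -/
structure Transducer (A B Q : Type*) where
  initial : Finset Q
  final : Finset Q
  trans : Finset (Transition A B Q)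
  finalOut : {q : Q // q ∈ final} → List B

/-- The projection of a word over the disjoint union of the two alphabets to the input alphabet. -/
def inputProj {A B : Type*} : List (A ⊕ B) → List A
  | [] => []
  | Sum.inl a :: w => a :: inputProj w
  | Sum.inr _ :: w => inputProj w

/-- The projection of a word over the disjoint union of the two alphabets to the output alphabet. -/
def outputProj {A B : Type*} : List (A ⊕ B) → List B
  | [] => []
  | Sum.inl _ :: w => outputProj w
  | Sum.inr b :: w => b :: outputProj w

/-- Two words are equivalent if they have the same input and the same output. -/
def WordEquiv {A B : Type*} (w w' : List (A ⊕ B)) : Prop :=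
  inputProj w = inputProj w' ∧ outputProj w = outputProj w'

/-- For `w = s₀ a₁ s₁ a₂ s₂ … aₙ sₙ` with input letters `aᵢ` and output words `sᵢ`, the word
`s₀ s₁ … sⱼ` (for `j ≤ n`): the output produced before the input letter number `j + 1`. -/
def outputUpTo {A B : Type*} : List (A ⊕ B) → ℕ → List B
  | [], _ => []
  | Sum.inr b :: w, j => b :: outputUpTo w j
  | Sum.inl _ :: _, 0 => []
  | Sum.inl _ :: w, j + 1 => outputUpTo w j

/-- The delay `v⁻¹ u` of two words, in the free group; its reduced form is the delay as a word over
the letters and their formal inverses. -/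
def delay {B : Type*} (u v : List B) : FreeGroup B :=
  ((v.map FreeGroup.of).prod)⁻¹ * (u.map FreeGroup.of).prod

/-- The lag of two words with the same input `a₁ … aₙ`: if `w = s₀ a₁ s₁ … aₙ sₙ` and
`w' = t₀ a₁ t₁ … aₙ tₙ`, it is the maximum over `0 ≤ j ≤ n` of the length of the reduced form of the
delay of `s₀ … sⱼ` and `t₀ … tⱼ`. -/
def lag {A B : Type*} [DecidableEq B] (w w' : List (A ⊕ B)) : ℕ :=
  (Finset.range ((inputProj w).length + 1)).sup fun j =>
    (delay (outputUpTo w j) (outputUpTo w' j)).norm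

namespace Transducer

variable {A B Q : Type*}

/-- Every transition reads exactly one input letter. -/
def IsRealTime (T : Transducer A B Q) : Prop :=
  ∀ t ∈ T.trans, t.inp.length = 1

/-- `T.IsPath p l q`: the transitions in `l` belong to `T` and lead consecutively from `p` to `q`. -/
def IsPath (T : Transducer A B Q) : Q → List (Transition A B Q) → Q → Prop
  | p, [], q => p = q
  | p, t :: l, q => t ∈ T.trans ∧ t.src = p ∧ T.IsPath t.tgt l q

/-- An accepting run: a sequence of consecutive transitions from an initial to a final state. -/
structure AcceptingRun (T : Transducer A B Q) where
  first : Q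
  steps : List (Transition A B Q)
  last : Q
  first_mem : first ∈ T.initial
  isPath : T.IsPath first steps last
  last_mem : last ∈ T.final

/-- The input word read by an accepting run. -/
def AcceptingRun.input {T : Transducer A B Q} (r : T.AcceptingRun) : List A :=
  r.steps.flatMap fun t => t.inp

/-- The word accepted by a run: `u₁ v₁ u₂ v₂ … uₙ vₙ f(q)`, where `uᵢ|vᵢ` are the labels of its
transitions and `q` is its last state. -/
def AcceptingRun.word {T : Transducer A B Q} (r : T.AcceptingRun) : List (A ⊕ B) :=
  (r.steps.flatMap fun t => t.inp.map Sum.inl ++ t.out.map Sum.inr) ++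
    (T.finalOut ⟨r.last, r.last_mem⟩).map Sum.inr

/-- The language of `T` over the disjoint union of the two alphabets. -/
def language (T : Transducer A B Q) : Set (List (A ⊕ B)) :=
  {w | ∃ r : T.AcceptingRun, r.word = w}

/-- The transduction (relation between input and output words) defined by `T`. -/
def relation (T : Transducer A B Q) : Set (List A × List B) :=
  {p | ∃ w ∈ T.language, p = (inputProj w, outputProj w)}

/-- `T` is `m`-ambiguous: every input word has at most `m` accepting runs. -/
def IsAmbiguousLE (T : Transducer A B Q) (m : ℕ) : Prop :=
  ∀ u : List A, {r : T.AcceptingRun | r.input = u}.encard ≤ m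

/-- The inclusion of `T₁` in `T₂`: inclusion of the transductions. -/
def Included {Q₁ Q₂ : Type*} (T₁ : Transducer A B Q₁) (T₂ : Transducer A B Q₂) : Prop :=
  T₁.relation ⊆ T₂.relation

/-- The `k`-inclusion of `T₁` in `T₂`: every word accepted by `T₁` has an equivalent word
accepted by `T₂` at lag at most `k`. -/
def KIncluded {Q₁ Q₂ : Type*} [DecidableEq B] (k : ℕ)
    (T₁ : Transducer A B Q₁) (T₂ : Transducer A B Q₂) : Prop :=
  ∀ w ∈ T₁.language, ∃ w' ∈ T₂.language, WordEquiv w w' ∧ lag w w' ≤ k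

/-- The maximal length of an output word on a transition, or of a final output word. -/
def maxOutputLength (T : Transducer A B Q) : ℕ :=
  max (T.trans.sup fun t => t.out.length)
    (T.final.attach.sup fun q => (T.finalOut q).length)

end Transducer

/-!
The proof is a pumping argument. Suppose that some run `r` of `T₁` is *lagging*: every run of `T₂`
with the same input and output has a delay of length more than `k` at some moment. Such a *matching*
run exists because of `T₁ ⊆ T₂`, and there are at most `m` of them. From a lagging run one
constructs a lagging run with fewer matching runs (`IsLagging.exists_ncard_lt`), which is impossible
in the long run (`Included.not_isLagging`).

To construct it, label each position of the input `u` of `r` by the state of `r`, the states of all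
accepting runs of `T₂` on `u`, and the set of states from which `T₂` accepts the remaining input.
The length of the delay of a matching run `ρ₀` starts at `0` and changes by at most `2M` in each
step, so a large delay forces two positions with equal labels and different delays
(`exists_pumpable_positions`). Now repeat `e` times the factor of `u` between these positions.

* By the choice of the labels and by bounded ambiguity, the accepting runs of `T₂` on the new input
  are precisely the pumped runs of `T₂` on `u` (`IsAmbiguousLE.exists_of_pumped`). The point is that
  a state of `T₂` has at most one loop over the factor, since two of them could be combined into
  more than `m` runs (`IsAmbiguousLE.loop_unique`).
* In the free group, an equality `a bᵉ c = a' b'ᵉ c'` for two different exponents implies that the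
  delays `a'⁻¹ a` and `(a' b')⁻¹ (a b)` agree, because roots are unique
  (`mul_eq_mul_of_pow_coincidences`). Hence, for large `e`, only runs with equal delays at both
  positions match after pumping; they matched before (`output_eq_of_pump`) and all their delays
  survive (`exists_delayAt_pumpList_eq`). So the pumped run is still lagging, and `ρ₀` is no longer
  among its matching runs.
-/

/-! ### Words in the free group -/

section Words

variable {B : Type*}

/-- The image of a word under the embedding of the free monoid into the free group. -/
def freeImage (u : List B) : FreeGroup B :=
  (u.map FreeGroup.of).prod

@[simp] theorem freeImage_nil : freeImage ([] : List B) = 1 := by simp [freeImage]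

@[simp] theorem freeImage_append (u v : List B) :
    freeImage (u ++ v) = freeImage u * freeImage v := by
  simp [freeImage]

@[simp] theorem freeImage_flatten_replicate (u : List B) (e : ℕ) :
    freeImage (List.replicate e u).flatten = freeImage u ^ e := by
  induction e with
  | zero => simp
  | succ e ih => rw [List.replicate_succ, List.flatten_cons, freeImage_append, ih, pow_succ']

theorem freeImage_eq_mk (u : List B) :
    freeImage u = FreeGroup.mk (u.map fun b => (b, true)) := by
  induction u with
  | nil => simp [FreeGroup.one_eq_mk]
  | cons b u ih =>
    have : freeImage (b :: u) = FreeGroup.of b * freeImage u := by simp [freeImage]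
    rw [this, ih, FreeGroup.of, FreeGroup.mul_mk]
    rfl

theorem freeImage_injective : Function.Injective (freeImage : List B → FreeGroup B) := by
  classical
  have hred : ∀ u : List B, FreeGroup.IsReduced (u.map fun b => (b, true)) := by
    intro u
    induction u with
    | nil => exact FreeGroup.IsReduced.nil
    | cons b u ih =>
      cases u with
      | nil => exact FreeGroup.IsReduced.singleton
      | cons c u =>
        simp only [List.map_cons] at ih ⊢
        exact FreeGroup.isReduced_cons_cons.2 ⟨fun _ => rfl, ih⟩
  intro u v h
  rw [freeImage_eq_mk, freeImage_eq_mk] at h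
  have h' := congrArg FreeGroup.toWord h
  rw [FreeGroup.toWord_mk, FreeGroup.toWord_mk, (hred u).reduce_eq, (hred v).reduce_eq] at h'
  exact List.map_injective_iff.2 (fun b c hbc => congrArg Prod.fst hbc) h'

theorem delay_eq (u v : List B) : delay u v = (freeImage v)⁻¹ * freeImage u := rfl

theorem norm_freeImage_le [DecidableEq B] (u : List B) : (freeImage u).norm ≤ u.length := by
  rw [freeImage_eq_mk]
  exact FreeGroup.norm_mk_le.trans (by simp)

theorem delay_append (u v u' v' : List B) :
    delay (u ++ u') (v ++ v') = (freeImage v')⁻¹ * delay u v * freeImage u' := by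
  simp only [delay_eq, freeImage_append]
  group

theorem norm_delay_append_le [DecidableEq B] (u v u' v' : List B) :
    (delay (u ++ u') (v ++ v')).norm ≤ (delay u v).norm + (u'.length + v'.length) := by
  rw [delay_append]
  have h₁ := FreeGroup.norm_mul_le ((freeImage v')⁻¹ * delay u v) (freeImage u')
  have h₂ := FreeGroup.norm_mul_le (freeImage v')⁻¹ (delay u v)
  rw [FreeGroup.norm_inv_eq] at h₂
  have h₃ := norm_freeImage_le u'
  have h₄ := norm_freeImage_le v'
  omega

@[simp] theorem delay_self (u : List B) : delay u u = 1 := by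
  simp [delay_eq]

end Words

/-- Since roots are unique in such a group, two coincidences
`a bᵉ c = a' b'ᵉ c'` force `b` and `b'` to be conjugate by `a'⁻¹ a`. -/
theorem mul_eq_mul_of_pow_coincidences {G : Type*} [Group G] [IsMulTorsionFree G]
    {a b c a' b' c' : G} {e f : ℕ} (hne : e ≠ f) (he : a * b ^ e * c = a' * b' ^ e * c')
    (hf : a * b ^ f * c = a' * b' ^ f * c') : a'⁻¹ * a * b = b' * (a'⁻¹ * a) := by
  wlog hlt : e < f generalizing e f
  · exact this hne.symm hf he (by omega)
  obtain ⟨n, hn, rfl⟩ : ∃ n, n ≠ 0 ∧ f = e + n := ⟨f - e, by omega, by omega⟩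
  have hd : a'⁻¹ * a * b ^ e * c = b' ^ e * c' := by
    rw [mul_assoc, mul_assoc, ← mul_assoc a, he]; group
  have hd' : a'⁻¹ * a * (b ^ n * (b ^ e * c)) = b' ^ n * (b' ^ e * c') := by
    have : a'⁻¹ * (a * b ^ (e + n) * c) = a'⁻¹ * (a' * b' ^ (e + n) * c') := by
      rw [hf]
    rw [add_comm e n, pow_add, pow_add] at this
    simpa [mul_assoc] using this
  rw [← hd] at hd'
  have hpow : a'⁻¹ * a * b ^ n = b' ^ n * (a'⁻¹ * a) := by
    apply mul_right_cancel (b := b ^ e * c)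
    simpa [mul_assoc] using hd'
  have hconj : (a'⁻¹ * a * b * (a'⁻¹ * a)⁻¹) ^ n = b' ^ n := by
    rw [conj_pow, hpow]; group
  have := pow_left_injective (M := G) (n := n) hn hconj
  rw [← this]; group

/-- If `b` and `b'` are conjugate by `a'⁻¹ a`, the coincidence `a bᵉ c = a' b'ᵉ c'` does not depend
on `e`. -/
theorem mul_pow_mul_eq_iff {G : Type*} [Group G] {a b c a' b' c' : G}
    (h : a'⁻¹ * a * b = b' * (a'⁻¹ * a)) (e : ℕ) :
    a * b ^ e * c = a' * b' ^ e * c' ↔ a'⁻¹ * a * c = c' := by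
  have hpow : a'⁻¹ * a * b ^ e = b' ^ e * (a'⁻¹ * a) :=
    (show SemiconjBy (a'⁻¹ * a) b b' from h).pow_right e
  have : a * b ^ e * c = a' * b' ^ e * (a'⁻¹ * a * c) := by
    calc a * b ^ e * c = a' * (a'⁻¹ * a * b ^ e) * c := by group
      _ = _ := by rw [hpow]; group
  rw [this, mul_right_inj]

/-- If `b` and `b'` are conjugate by `a'⁻¹ a`, repeating them does not change later delays. -/
theorem inv_mul_pow_mul {G : Type*} [Group G] {a b a' b' : G}
    (h : a'⁻¹ * a * b = b' * (a'⁻¹ * a)) (c c' : G) (e : ℕ) :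
    (a' * (b' ^ e * c'))⁻¹ * (a * (b ^ e * c)) = c'⁻¹ * (a'⁻¹ * a) * c := by
  have hpow : a'⁻¹ * a * b ^ e = b' ^ e * (a'⁻¹ * a) :=
    (show SemiconjBy (a'⁻¹ * a) b b' from h).pow_right e
  calc (a' * (b' ^ e * c'))⁻¹ * (a * (b ^ e * c))
      = c'⁻¹ * (b' ^ e)⁻¹ * (a'⁻¹ * a * b ^ e) * c := by group
    _ = _ := by rw [hpow]; group

/-! ### Projections of the words accepted by a transducer -/

section Projections

variable {A B : Type*}

@[simp] theorem inputProj_append (w w' : List (A ⊕ B)) :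
    inputProj (w ++ w') = inputProj w ++ inputProj w' := by
  induction w with
  | nil => rfl
  | cons x w ih => cases x <;> simp [inputProj, ih]

@[simp] theorem outputProj_append (w w' : List (A ⊕ B)) :
    outputProj (w ++ w') = outputProj w ++ outputProj w' := by
  induction w with
  | nil => rfl
  | cons x w ih => cases x <;> simp [outputProj, ih]

@[simp] theorem inputProj_map_inl (u : List A) : inputProj (u.map (Sum.inl (β := B))) = u := by
  induction u <;> simp_all [inputProj]

@[simp] theorem inputProj_map_inr (v : List B) : inputProj (v.map (Sum.inr (α := A))) = [] := by
  induction v <;> simp_all [inputProj]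

@[simp] theorem outputProj_map_inl (u : List A) : outputProj (u.map (Sum.inl (β := B))) = [] := by
  induction u <;> simp_all [outputProj]

@[simp] theorem outputProj_map_inr (v : List B) : outputProj (v.map (Sum.inr (α := A))) = v := by
  induction v <;> simp_all [outputProj]

theorem outputUpTo_map_inr_append (v : List B) (w : List (A ⊕ B)) (j : ℕ) :
    outputUpTo (v.map Sum.inr ++ w) j = v ++ outputUpTo w j := by
  induction v with
  | nil => rfl
  | cons b v ih => simp [outputUpTo, ih]

theorem outputUpTo_length_inputProj (w : List (A ⊕ B)) :
    outputUpTo w (inputProj w).length = outputProj w := by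
  induction w with
  | nil => rfl
  | cons x w ih => cases x <;> simp [outputUpTo, inputProj, outputProj, ih]

end Projections

/-! ### Inputs and outputs of runs -/

namespace Transducer

variable {A B Q : Type*}

/-- The input word read by a list of transitions. -/
def stepsInput (l : List (Transition A B Q)) : List A := l.flatMap Transition.inp

/-- The output word produced by a list of transitions. -/
def stepsOutput (l : List (Transition A B Q)) : List B := l.flatMap Transition.out

@[simp] theorem stepsInput_append (l l' : List (Transition A B Q)) :
    stepsInput (l ++ l') = stepsInput l ++ stepsInput l' := by simp [stepsInput]

@[simp] theorem stepsOutput_nil : stepsOutput ([] : List (Transition A B Q)) = [] := rfl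

@[simp] theorem stepsOutput_append (l l' : List (Transition A B Q)) :
    stepsOutput (l ++ l') = stepsOutput l ++ stepsOutput l' := by simp [stepsOutput]

theorem stepsInput_flatten_replicate (l : List (Transition A B Q)) (e : ℕ) :
    stepsInput (List.replicate e l).flatten = (List.replicate e (stepsInput l)).flatten := by
  induction e with
  | zero => rfl
  | succ e ih => simp [List.replicate_succ, ih]

theorem stepsOutput_flatten_replicate (l : List (Transition A B Q)) (e : ℕ) :
    stepsOutput (List.replicate e l).flatten = (List.replicate e (stepsOutput l)).flatten := by
  induction e with
  | zero => rfl
  | succ e ih => simp [List.replicate_succ, ih]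

/-- The output word of an accepting run, final output included. -/
def AcceptingRun.output {T : Transducer A B Q} (r : T.AcceptingRun) : List B :=
  stepsOutput r.steps ++ T.finalOut ⟨r.last, r.last_mem⟩

theorem AcceptingRun.inputProj_word {T : Transducer A B Q} (r : T.AcceptingRun) :
    inputProj r.word = r.input := by
  have : ∀ l : List (Transition A B Q),
      inputProj (l.flatMap fun t => t.inp.map Sum.inl ++ t.out.map Sum.inr) = stepsInput l := by
    intro l
    induction l with
    | nil => rfl
    | cons t l ih => simp [ih, stepsInput]
  simp [AcceptingRun.word, AcceptingRun.input, this, stepsInput]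

theorem AcceptingRun.outputProj_word {T : Transducer A B Q} (r : T.AcceptingRun) :
    outputProj r.word = r.output := by
  have : ∀ l : List (Transition A B Q),
      outputProj (l.flatMap fun t => t.inp.map Sum.inl ++ t.out.map Sum.inr) = stepsOutput l := by
    intro l
    induction l with
    | nil => rfl
    | cons t l ih => simp [ih, stepsOutput]
  simp [AcceptingRun.word, AcceptingRun.output, this]

/-! ### Paths of real-time transducers -/

theorem isPath_append {T : Transducer A B Q} {p q : Q} {l l' : List (Transition A B Q)} :
    T.IsPath p (l ++ l') q ↔ ∃ s, T.IsPath p l s ∧ T.IsPath s l' q := by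
  induction l generalizing p with
  | nil => simp [IsPath]
  | cons t l ih => simp [IsPath, ih, and_assoc]

theorem IsPath.flatten {T : Transducer A B Q} {p : Q} {L : List (List (Transition A B Q))}
    (h : ∀ l ∈ L, T.IsPath p l p) : T.IsPath p L.flatten p := by
  induction L with
  | nil => rfl
  | cons l L ih =>
    rw [List.flatten_cons, isPath_append]
    exact ⟨p, h l (by simp), ih fun l' hl' => h l' (by simp [hl'])⟩

theorem IsPath.flatten_replicate {T : Transducer A B Q} {p : Q} {l : List (Transition A B Q)}
    (h : T.IsPath p l p) (e : ℕ) : T.IsPath p (List.replicate e l).flatten p :=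
  IsPath.flatten fun _ hl' => List.eq_of_mem_replicate hl' ▸ h

theorem IsPath.mem_trans {T : Transducer A B Q} {p q : Q} {l : List (Transition A B Q)}
    (h : T.IsPath p l q) : ∀ t ∈ l, t ∈ T.trans := by
  induction l generalizing p with
  | nil => simp
  | cons t l ih =>
    intro t' ht'
    rcases List.mem_cons.1 ht' with rfl | ht'
    · exact h.1
    · exact ih h.2.2 t' ht'

/-- The state reached from `p` by a list of transitions. -/
def endState : Q → List (Transition A B Q) → Q
  | p, [] => p
  | _, t :: l => endState t.tgt l

theorem IsPath.endState_eq {T : Transducer A B Q} {p q : Q} {l : List (Transition A B Q)}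
    (h : T.IsPath p l q) : endState p l = q := by
  induction l generalizing p with
  | nil => exact h
  | cons t l ih => exact ih h.2.2

theorem IsPath.length_stepsInput {T : Transducer A B Q} (hT : T.IsRealTime) {p q : Q}
    {l : List (Transition A B Q)} (h : T.IsPath p l q) : (stepsInput l).length = l.length := by
  induction l generalizing p with
  | nil => rfl
  | cons t l ih =>
    have := ih h.2.2
    have := hT t h.1
    simp_all [stepsInput]
    omega

theorem AcceptingRun.length_input {T : Transducer A B Q} (hT : T.IsRealTime)
    (r : T.AcceptingRun) : r.input.length = r.steps.length :=
  r.isPath.length_stepsInput hT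

/-- A factorization of the input of a path lifts to the path. -/
theorem IsPath.exists_split {T : Transducer A B Q} (hT : T.IsRealTime) {p q : Q}
    {l : List (Transition A B Q)} {u v : List A} (h : T.IsPath p l q)
    (hl : stepsInput l = u ++ v) :
    ∃ l₁ l₂ s, l = l₁ ++ l₂ ∧ T.IsPath p l₁ s ∧ T.IsPath s l₂ q ∧ stepsInput l₁ = u ∧
      stepsInput l₂ = v := by
  have hlen := h.length_stepsInput hT
  rw [← List.take_append_drop u.length l, isPath_append] at h
  obtain ⟨s, h₁, h₂⟩ := h
  have hi : stepsInput (l.take u.length) ++ stepsInput (l.drop u.length) = u ++ v := by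
    rw [← stepsInput_append, List.take_append_drop, hl]
  have hl₁ := h₁.length_stepsInput hT
  rw [hl, List.length_append] at hlen
  rw [List.length_take, ← hlen, Nat.min_eq_left (by omega)] at hl₁
  obtain ⟨e₁, e₂⟩ := List.append_inj hi hl₁
  exact ⟨_, _, s, (List.take_append_drop u.length l).symm, h₁, h₂, e₁, e₂⟩

theorem AcceptingRun.outputUpTo_word {T : Transducer A B Q} (hT : T.IsRealTime)
    (r : T.AcceptingRun) {j : ℕ} (hj : j < r.steps.length) :
    outputUpTo r.word j = stepsOutput (r.steps.take j) := by
  have key : ∀ (l : List (Transition A B Q)) (w : List (A ⊕ B)) (j : ℕ),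
      (∀ t ∈ l, t ∈ T.trans) → j < l.length →
      outputUpTo ((l.flatMap fun t => t.inp.map Sum.inl ++ t.out.map Sum.inr) ++ w) j =
        stepsOutput (l.take j) := by
    intro l w
    induction l with
    | nil => intro j _ hj; simp at hj
    | cons t l ih =>
      intro j hl hj
      obtain ⟨a, ha⟩ := List.length_eq_one_iff.1 (hT t (hl t (by simp)))
      cases j with
      | zero => simp [ha, outputUpTo]
      | succ j =>
        have := ih j (fun t' ht' => hl t' (by simp [ht'])) (by simpa using hj)
        simp only [List.flatMap_cons, ha, List.map_cons, List.map_nil, List.cons_append,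
          List.nil_append, List.append_assoc, outputUpTo, outputUpTo_map_inr_append, this]
        simp [stepsOutput]
  exact key _ _ _ r.isPath.mem_trans hj

/-- The states from which `T` accepts the input word `u`. -/
def Accepts (T : Transducer A B Q) (q : Q) (u : List A) : Prop :=
  ∃ l, ∃ s ∈ T.final, T.IsPath q l s ∧ stepsInput l = u

/-! ### Pumping -/

/-- The list `l` with its factor between the positions `x` and `y` repeated `e` times. -/
def pumpList {α : Type*} (x y e : ℕ) (l : List α) : List α :=
  l.take x ++ ((List.replicate e ((l.take y).drop x)).flatten ++ l.drop y)

theorem pumpList_append {α : Type*} {a b c : List α} {x y : ℕ} (hx : a.length = x)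
    (hy : (a ++ b).length = y) (e : ℕ) :
    pumpList x y e (a ++ (b ++ c)) = a ++ ((List.replicate e b).flatten ++ c) := by
  subst hx hy
  have h : List.take (a ++ b).length (a ++ (b ++ c)) = a ++ b := by
    rw [← List.append_assoc, List.take_left]
  have h' : List.drop (a ++ b).length (a ++ (b ++ c)) = c := by
    rw [← List.append_assoc, List.drop_left]
  rw [pumpList, h, h', List.take_left, List.drop_left]

theorem take_append_flatten_replicate_of_le {α : Type*} {a b c : List α} {j : ℕ} (e : ℕ)
    (hj : j ≤ (a ++ b).length) :
    (a ++ ((List.replicate (e + 1) b).flatten ++ c)).take j = (a ++ (b ++ c)).take j := by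
  have h : a ++ ((List.replicate (e + 1) b).flatten ++ c) =
      (a ++ b) ++ ((List.replicate e b).flatten ++ c) := by
    simp [List.replicate_succ]
  rw [h, ← List.append_assoc a b c, List.take_append_of_le_length hj,
    List.take_append_of_le_length hj]

theorem take_append_flatten_replicate_of_ge {α : Type*} {a b c : List α} {y : ℕ} (e i : ℕ)
    (hy : (a ++ b).length = y) :
    (a ++ ((List.replicate (e + 1) b).flatten ++ c)).take (y + e * b.length + i) =
      a ++ ((List.replicate (e + 1) b).flatten ++ c.take i) := by
  have h : (a ++ (List.replicate (e + 1) b).flatten).length = y + e * b.length := by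
    rw [← hy]; simp; ring
  rw [← h, ← List.append_assoc, List.take_length_add_append, List.append_assoc]

theorem exists_split₃ {α : Type*} {x y : ℕ} (hxy : x ≤ y) (l : List α) (hy : y ≤ l.length) :
    ∃ a b c, l = a ++ (b ++ c) ∧ a.length = x ∧ (a ++ b).length = y ∧ l.take x = a ∧
      l.take y = a ++ b := by
  refine ⟨l.take x, (l.take y).drop x, l.drop y, ?_, ?_, ?_, rfl, ?_⟩
  · conv_lhs => rw [← List.take_append_drop y l, ← List.take_append_drop x (l.take y)]
    rw [List.take_take, Nat.min_eq_left hxy, List.append_assoc]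
  · simp; omega
  · simp; omega
  · conv_lhs => rw [← List.take_append_drop x (l.take y)]
    rw [List.take_take, Nat.min_eq_left hxy]

/-- The run obtained from `r` by repeating `e` times its part between the positions `x` and `y`, at
which it is in the same state. -/
def AcceptingRun.pump {T : Transducer A B Q} (r : T.AcceptingRun) {x y : ℕ} (hxy : x ≤ y)
    (h : endState r.first (r.steps.take x) = endState r.first (r.steps.take y)) (e : ℕ) :
    T.AcceptingRun where
  first := r.first
  steps := pumpList x y e r.steps
  last := r.last
  first_mem := r.first_mem
  isPath := by
    have hp := r.isPath
    rw [← List.take_append_drop y r.steps, isPath_append] at hp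
    obtain ⟨s', hp, h₃⟩ := hp
    have e₂ := hp.endState_eq
    rw [← List.take_append_drop x (r.steps.take y), List.take_take, Nat.min_eq_left hxy,
      isPath_append] at hp
    obtain ⟨s, h₁, h₂⟩ := hp
    have e₁ := h₁.endState_eq
    obtain rfl : s = s' := by rw [← e₁, ← e₂, h]
    exact isPath_append.2 ⟨s, h₁, isPath_append.2 ⟨s, h₂.flatten_replicate e, h₃⟩⟩
  last_mem := r.last_mem

theorem AcceptingRun.ext' {T : Transducer A B Q} {r r' : T.AcceptingRun}
    (h₁ : r.first = r'.first) (h₂ : r.steps = r'.steps) (h₃ : r.last = r'.last) : r = r' := by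
  cases r; cases r'; simp_all

/-- In a transducer of bounded ambiguity, a loop that is part of an accepting run is determined by
its state and its input: two different loops could be combined into arbitrarily many accepting runs
on the same input. -/
theorem IsAmbiguousLE.loop_unique {T : Transducer A B Q} {m : ℕ} (hm : T.IsAmbiguousLE m)
    (hT : T.IsRealTime) {i p f : Q} {a b b' c : List (Transition A B Q)}
    (hi : i ∈ T.initial) (hf : f ∈ T.final) (ha : T.IsPath i a p) (hb : T.IsPath p b p)
    (hb' : T.IsPath p b' p) (hc : T.IsPath p c f) (hbb : stepsInput b = stepsInput b') :
    b = b' := by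
  by_contra hne
  have hlen : b.length = b'.length := by
    rw [← hb.length_stepsInput hT, ← hb'.length_stepsInput hT, hbb]
  -- The `n`-th run follows `b'` in the round number `n`, and `b` in the other rounds.
  let L : Fin (m + 1) → List (List (Transition A B Q)) := fun n =>
    List.ofFn fun j : Fin (m + 1) => if j = n then b' else b
  have hL : ∀ n, ∀ l ∈ L n, l = b ∨ l = b' := by
    intro n l hl
    obtain ⟨j, rfl⟩ := (List.mem_ofFn' _ _).1 hl
    by_cases hj : j = n <;> simp [hj]
  let R : Fin (m + 1) → T.AcceptingRun := fun n =>
    { first := i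
      steps := a ++ ((L n).flatten ++ c)
      last := f
      first_mem := hi
      isPath := isPath_append.2 ⟨p, ha, isPath_append.2 ⟨p, IsPath.flatten fun l hl => by
        rcases hL n l hl with rfl | rfl <;> assumption, hc⟩⟩
      last_mem := hf }
  have hinj : Function.Injective R := by
    intro n n' h
    have h₁ : a ++ ((L n).flatten ++ c) = a ++ ((L n').flatten ++ c) :=
      congrArg AcceptingRun.steps h
    have h₂ := List.append_cancel_right (List.append_cancel_left h₁)
    have hl : ∀ n, (L n).map List.length = List.replicate (m + 1) b.length := by
      intro n
      refine List.eq_replicate_iff.2 ⟨by simp [L], ?_⟩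
      intro k hk
      obtain ⟨l, hl, rfl⟩ := List.mem_map.1 hk
      rcases hL n l hl with rfl | rfl
      · rfl
      · exact hlen.symm
    have h₃ := List.eq_iff_flatten_eq.2 ⟨h₂, (hl n).trans (hl n').symm⟩
    have h₄ := congrFun (List.ofFn_injective h₃) n
    by_contra hnn
    rw [if_pos rfl, if_neg hnn] at h₄
    exact hne h₄.symm
  have hinput : ∀ n, (R n).input =
      stepsInput a ++ ((List.replicate (m + 1) (stepsInput b)).flatten ++ stepsInput c) := by
    intro n
    change stepsInput (a ++ ((L n).flatten ++ c)) = _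
    have : stepsInput (L n).flatten = ((L n).map stepsInput).flatten := by
      induction L n with
      | nil => rfl
      | cons l L ih => simp [ih]
    rw [stepsInput_append, stepsInput_append, this]
    congr 3
    refine List.eq_replicate_iff.2 ⟨by simp [L], ?_⟩
    intro k hk
    obtain ⟨l, hl, rfl⟩ := List.mem_map.1 hk
    rcases hL n l hl with rfl | rfl
    · rfl
    · exact hbb.symm
  have hle := (Set.encard_le_encard (s := Set.range R) (by
    rintro _ ⟨n, rfl⟩; exact hinput n)).trans (hm _)
  rw [← Set.image_univ, hinj.encard_image, Set.encard_univ, ENat.card_eq_coe_fintype_card,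
    Fintype.card_fin] at hle
  exact absurd (Nat.cast_le.1 hle) (by omega)

/-- Let `u₀ u₁ u₂` be an input such that every accepting run on it is in the same state
before and after `u₁`, and the same states accept `u₁ u₂` and `u₂`. Then the accepting runs on
`u₀ u₁ᵉ u₂` arise from those on `u₀ u₁ u₂` by repeating the loop on `u₁`. -/
theorem IsAmbiguousLE.exists_of_pumped {T : Transducer A B Q} {m : ℕ} (hm : T.IsAmbiguousLE m)
    (hT : T.IsRealTime) {u₀ u₁ u₂ : List A}
    (hacc : ∀ q, T.Accepts q (u₁ ++ u₂) ↔ T.Accepts q u₂)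
    (hloop : ∀ {i s s' f : Q} {a b c : List (Transition A B Q)}, i ∈ T.initial → f ∈ T.final →
      T.IsPath i a s → T.IsPath s b s' → T.IsPath s' c f → stepsInput a = u₀ →
      stepsInput b = u₁ → stepsInput c = u₂ → s = s') (e : ℕ) (r' : T.AcceptingRun)
    (hr' : r'.input = u₀ ++ ((List.replicate e u₁).flatten ++ u₂)) :
    ∃ p a b c, T.IsPath r'.first a p ∧ T.IsPath p b p ∧ T.IsPath p c r'.last ∧
      stepsInput a = u₀ ∧ stepsInput b = u₁ ∧ stepsInput c = u₂ ∧
      r'.steps = a ++ ((List.replicate e b).flatten ++ c) := by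
  obtain ⟨a, l, p, hl, ha, hp, hau, hlu⟩ := r'.isPath.exists_split hT hr'
  obtain ⟨d, c, s, hd, hpd, hc, hdu, hcu⟩ := hp.exists_split hT hlu
  have hs : T.Accepts s u₂ := ⟨c, r'.last, r'.last_mem, hc, hcu⟩
  -- The states that accept `u₂` are closed under going back along `u₁`.
  have hback : ∀ (e : ℕ) {q s : Q} {d : List (Transition A B Q)}, T.IsPath q d s →
      stepsInput d = (List.replicate e u₁).flatten → T.Accepts s u₂ → T.Accepts q u₂ := by
    intro e
    induction e with
    | zero =>
      intro q s d hd hdu hs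
      have := hd.length_stepsInput hT
      rw [hdu] at this
      obtain rfl : d = [] := List.length_eq_zero_iff.1 (by simpa using this.symm)
      obtain rfl : q = s := hd
      exact hs
    | succ e ih =>
      intro q s d hd hdu hs
      rw [List.replicate_succ, List.flatten_cons] at hdu
      obtain ⟨d₁, d₂, q', -, h₁, h₂, hu₁, hu₂⟩ := hd.exists_split hT hdu
      obtain ⟨l, f, hf, hl, hlu⟩ := ih h₂ hu₂ hs
      exact (hacc q).1 ⟨d₁ ++ l, f, hf, isPath_append.2 ⟨q', h₁, hl⟩, by simp [hu₁, hlu]⟩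
  -- Hence `p` lies on an accepting run on `u₀ u₁ u₂`, which provides a loop `b` on `u₁` at `p`.
  obtain ⟨l₀, f₀, hf₀, hl₀, hlu₀⟩ := (hacc p).2 (hback e hpd hdu hs)
  obtain ⟨b, c₀, p', -, hb, hc₀, hbu, hcu₀⟩ := hl₀.exists_split hT hlu₀
  obtain rfl := hloop r'.first_mem hf₀ ha hb hc₀ hau hbu hcu₀
  -- Each round starts and ends at `p`, and therefore follows `b`.
  have key : ∀ (e : ℕ) {s : Q} {d : List (Transition A B Q)}, T.IsPath p d s →
      stepsInput d = (List.replicate e u₁).flatten → T.Accepts s u₂ →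
      s = p ∧ d = (List.replicate e b).flatten := by
    intro e
    induction e with
    | zero =>
      intro s d hd hdu _
      have := hd.length_stepsInput hT
      rw [hdu] at this
      obtain rfl : d = [] := List.length_eq_zero_iff.1 (by simpa using this.symm)
      exact ⟨Eq.symm hd, rfl⟩
    | succ e ih =>
      intro s d hd hdu hs
      rw [List.replicate_succ, List.flatten_cons] at hdu
      obtain ⟨d₁, d₂, q', rfl, h₁, h₂, hu₁, hu₂⟩ := hd.exists_split hT hdu
      obtain ⟨l, f, hf, hl, hlu⟩ := hback e h₂ hu₂ hs
      obtain rfl := hloop r'.first_mem hf ha h₁ hl hau hu₁ hlu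
      obtain ⟨rfl, rfl⟩ := ih h₂ hu₂ hs
      rw [hm.loop_unique hT r'.first_mem hf₀ ha h₁ hb hc₀ (hu₁.trans hbu.symm)]
      exact ⟨rfl, by rw [List.replicate_succ, List.flatten_cons]⟩
  obtain ⟨rfl, rfl⟩ := key e hpd hdu hs
  exact ⟨s, a, b, c, ha, hb, hc, hau, hbu, hcu, by rw [hl, hd]⟩

variable {Q' : Type*}

/-! ### The effect of pumping on outputs and delays -/

/-- The delay between the outputs of two lists of transitions after `j` transitions. -/
def delayAt (l : List (Transition A B Q)) (l' : List (Transition A B Q')) (j : ℕ) : FreeGroup B :=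
  delay (stepsOutput (l.take j)) (stepsOutput (l'.take j))

/-- If pumping by infinitely many exponents yields equal outputs, the pumped factors do not change
the delay. -/
theorem eventually_delayAt_eq {x y : ℕ} (hxy : x ≤ y) (l : List (Transition A B Q))
    (l' : List (Transition A B Q')) (hy : y ≤ l.length) (hy' : y ≤ l'.length) (g g' : List B) :
    ∀ᶠ e in Filter.atTop, stepsOutput (pumpList x y e l) ++ g =
      stepsOutput (pumpList x y e l') ++ g' → delayAt l l' y = delayAt l l' x := by
  obtain ⟨a, b, c, rfl, hx, hab, htx, hty⟩ := exists_split₃ hxy l hy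
  obtain ⟨a', b', c', rfl, hx', hab', htx', hty'⟩ := exists_split₃ hxy l' hy'
  by_cases hd : delayAt (a ++ (b ++ c)) (a' ++ (b' ++ c')) y =
      delayAt (a ++ (b ++ c)) (a' ++ (b' ++ c')) x
  · exact Filter.Eventually.of_forall fun _ _ => hd
  have hsub : {e : ℕ | stepsOutput (pumpList x y e (a ++ (b ++ c))) ++ g =
      stepsOutput (pumpList x y e (a' ++ (b' ++ c'))) ++ g'}.Subsingleton := by
    intro e he f hf
    by_contra hne
    rw [Set.mem_ofPred_eq, pumpList_append hx hab, pumpList_append hx' hab'] at he hf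
    have he' := congrArg freeImage he
    have hf' := congrArg freeImage hf
    simp only [stepsOutput_append, stepsOutput_flatten_replicate, freeImage_append,
      freeImage_flatten_replicate, mul_assoc] at he' hf'
    have := mul_eq_mul_of_pow_coincidences (a := freeImage (stepsOutput a))
      (b := freeImage (stepsOutput b)) (a' := freeImage (stepsOutput a'))
      (b' := freeImage (stepsOutput b')) hne
      (by rw [mul_assoc, mul_assoc]; exact he') (by rw [mul_assoc, mul_assoc]; exact hf')
    apply hd
    rw [delayAt, delayAt, htx, hty, htx', hty', stepsOutput_append, stepsOutput_append,
      delay_append, delay_eq, mul_assoc, this, inv_mul_cancel_left]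
  have hfin := hsub.finite.eventually_cofinite_notMem
  rw [Nat.cofinite_eq_atTop] at hfin
  filter_upwards [hfin] with e he h using absurd h he

/-- Pumping factors that do not change the delay cannot turn different outputs into equal ones. -/
theorem output_eq_of_pump {x y : ℕ} (hxy : x ≤ y) (l : List (Transition A B Q))
    (l' : List (Transition A B Q')) (hy : y ≤ l.length) (hy' : y ≤ l'.length) (g g' : List B)
    (hd : delayAt l l' y = delayAt l l' x) {e : ℕ}
    (h : stepsOutput (pumpList x y e l) ++ g = stepsOutput (pumpList x y e l') ++ g') :
    stepsOutput l ++ g = stepsOutput l' ++ g' := by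
  obtain ⟨a, b, c, rfl, hx, hab, htx, hty⟩ := exists_split₃ hxy l hy
  obtain ⟨a', b', c', rfl, hx', hab', htx', hty'⟩ := exists_split₃ hxy l' hy'
  rw [delayAt, delayAt, htx, hty, htx', hty', stepsOutput_append, stepsOutput_append,
    delay_append, delay_eq, mul_assoc, inv_mul_eq_iff_eq_mul] at hd
  rw [pumpList_append hx hab, pumpList_append hx' hab'] at h
  apply freeImage_injective
  have h' := congrArg freeImage h
  simp only [stepsOutput_append, stepsOutput_flatten_replicate, freeImage_append,
    freeImage_flatten_replicate, mul_assoc] at h'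
  have h₁ := (mul_pow_mul_eq_iff hd e).1 (by rw [mul_assoc, mul_assoc]; exact h')
  have h₂ := (mul_pow_mul_eq_iff hd 1).2 h₁
  simpa [mul_assoc] using h₂

/-- Pumping a factor that does not change the delay preserves the delays that occur. -/
theorem exists_delayAt_pumpList_eq {x y : ℕ} (hxy : x ≤ y) (l : List (Transition A B Q))
    (l' : List (Transition A B Q')) (hy : y ≤ l.length) (hy' : y ≤ l'.length)
    (hd : delayAt l l' y = delayAt l l' x) {e : ℕ} (he : e ≠ 0) {j : ℕ} (hj : j < l.length) :
    ∃ j' < (pumpList x y e l).length,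
      delayAt (pumpList x y e l) (pumpList x y e l') j' = delayAt l l' j := by
  obtain ⟨a, b, c, rfl, hx, hab, htx, hty⟩ := exists_split₃ hxy l hy
  obtain ⟨a', b', c', rfl, hx', hab', htx', hty'⟩ := exists_split₃ hxy l' hy'
  obtain ⟨e, rfl⟩ := Nat.exists_eq_succ_of_ne_zero he
  rw [pumpList_append hx hab, pumpList_append hx' hab']
  have hb : b.length = b'.length := by simp at hab hab'; omega
  rcases le_total j y with hjy | hjy
  · -- The first pass through the factor is unchanged.
    refine ⟨j, ?_, ?_⟩
    · simp at hj ⊢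
      nlinarith
    · rw [delayAt, delayAt, Nat.succ_eq_add_one,
        take_append_flatten_replicate_of_le e (hjy.trans_eq hab.symm),
        take_append_flatten_replicate_of_le e (hjy.trans_eq hab'.symm)]
  · -- After the factor, positions are shifted by the length of the additional rounds.
    obtain ⟨i, rfl⟩ := Nat.exists_eq_add_of_le hjy
    rw [delayAt, delayAt, htx, hty, htx', hty', stepsOutput_append, stepsOutput_append,
      delay_append, delay_eq, mul_assoc, inv_mul_eq_iff_eq_mul] at hd
    have ht := take_append_flatten_replicate_of_ge (c := c) 0 i hab
    have ht' := take_append_flatten_replicate_of_ge (c := c') 0 i hab'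
    simp only [zero_mul, add_zero, zero_add, List.replicate_one, List.flatten_singleton] at ht ht'
    refine ⟨y + e * b.length + i, ?_, ?_⟩
    · simp at hj hab ⊢
      nlinarith
    · rw [delayAt, delayAt, ht, ht', Nat.succ_eq_add_one,
        take_append_flatten_replicate_of_ge e i hab, hb,
        take_append_flatten_replicate_of_ge e i hab']
      simp only [delay_eq, stepsOutput_append, stepsOutput_flatten_replicate, freeImage_append,
        freeImage_flatten_replicate]
      rw [inv_mul_pow_mul hd]
      simpa using (inv_mul_pow_mul hd _ _ 1).symm

/-! ### Runs with large lag -/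

/-- The accepting runs of `T₂` with the same input and the same output as the run `r` of `T₁`. -/
def matchingRuns {T₁ : Transducer A B Q} (T₂ : Transducer A B Q') (r : T₁.AcceptingRun) :
    Set T₂.AcceptingRun :=
  {ρ | ρ.input = r.input ∧ ρ.output = r.output}

/-- Every run of `T₂` with the same input and output as `r` has a delay of length more than `k` with
respect to `r` before the last transition of `r`. -/
def IsLagging [DecidableEq B] {T₁ : Transducer A B Q} (T₂ : Transducer A B Q') (k : ℕ)
    (r : T₁.AcceptingRun) : Prop :=
  ∀ ρ ∈ matchingRuns T₂ r, ∃ j < r.steps.length, k < (delayAt r.steps ρ.steps j).norm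

/-- Pumping a lagging run `r` of `T₁` at two positions where `r` and all runs of `T₂` on the same
input are in the same states, and where the remaining inputs are accepted from the same states,
gives a lagging run that is matched by fewer runs of `T₂`, if some matching run `ρ₀` has different delays
at the two positions. -/
theorem IsLagging.exists_ncard_lt [DecidableEq B] {T₁ : Transducer A B Q}
    {T₂ : Transducer A B Q'} {m k : ℕ} (hT₁ : T₁.IsRealTime) (hT₂ : T₂.IsRealTime)
    (hm : T₂.IsAmbiguousLE m) {r : T₁.AcceptingRun} (hr : IsLagging T₂ k r)
    {ρ₀ : T₂.AcceptingRun} (hρ₀ : ρ₀ ∈ matchingRuns T₂ r) {x y : ℕ} (hxy : x ≤ y)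
    (hy : y ≤ r.steps.length)
    (hstate : endState r.first (r.steps.take x) = endState r.first (r.steps.take y))
    (hstates : ∀ ρ : T₂.AcceptingRun, ρ.input = r.input →
      endState ρ.first (ρ.steps.take x) = endState ρ.first (ρ.steps.take y))
    (hacc : ∀ q, T₂.Accepts q (r.input.drop x) ↔ T₂.Accepts q (r.input.drop y))
    (hdelay : delayAt r.steps ρ₀.steps y ≠ delayAt r.steps ρ₀.steps x) :
    ∃ r' : T₁.AcceptingRun, IsLagging T₂ k r' ∧
      (matchingRuns T₂ r').ncard < (matchingRuns T₂ r).ncard := by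
  have hlength : ∀ ρ : T₂.AcceptingRun, ρ.input = r.input → ρ.steps.length = r.steps.length :=
    fun ρ hρ => by rw [← ρ.length_input hT₂, hρ, r.length_input hT₁]
  have hfin : {ρ : T₂.AcceptingRun | ρ.input = r.input}.Finite :=
    Set.finite_of_encard_le_coe (hm r.input)
  have hfin' : (matchingRuns T₂ r).Finite := hfin.subset fun ρ hρ => hρ.1
  -- An exponent for which only runs with equal delays at `x` and `y` match after pumping.
  obtain ⟨e, he, he₀⟩ := (((Filter.eventually_all_finite hfin).2 fun ρ hρ =>
    eventually_delayAt_eq hxy r.steps ρ.steps hy (hy.trans_eq (hlength ρ hρ).symm)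
      (T₁.finalOut ⟨r.last, r.last_mem⟩) (T₂.finalOut ⟨ρ.last, ρ.last_mem⟩)).and
    (Filter.eventually_ne_atTop 0)).exists
  set u₀ := r.input.take x with hu₀
  set u₁ := (r.input.take y).drop x with hu₁
  set u₂ := r.input.drop y with hu₂
  have hu₁₂ : r.input.drop x = u₁ ++ u₂ := by
    rw [hu₁, hu₂, List.drop_take]
    conv_lhs => rw [← List.take_append_drop (y - x) (r.input.drop x)]
    rw [List.drop_drop, Nat.add_sub_cancel' hxy]
  have hu : r.input = u₀ ++ (u₁ ++ u₂) := by rw [← hu₁₂, List.take_append_drop]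
  have hylen : y ≤ r.input.length := hy.trans_eq (r.length_input hT₁).symm
  have hlu₀ : u₀.length = x := by rw [hu₀, List.length_take]; omega
  have hlu₁ : u₁.length = y - x := by rw [hu₁, List.length_drop, List.length_take]; omega
  rw [hu₁₂] at hacc
  let r' := r.pump hxy hstate e
  have hinput : r'.input = u₀ ++ ((List.replicate e u₁).flatten ++ u₂) := by
    obtain ⟨a, b, c, habc, ha, hab, -, -⟩ := exists_split₃ hxy r.steps hy
    change stepsInput (pumpList x y e r.steps) = _
    have hp := r.isPath
    rw [habc, isPath_append] at hp
    obtain ⟨s, h₁, hp⟩ := hp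
    obtain ⟨s', h₂, h₃⟩ := isPath_append.1 hp
    have hi : r.input = stepsInput a ++ (stepsInput b ++ stepsInput c) := by
      rw [← stepsInput_append, ← stepsInput_append, ← habc]; rfl
    rw [hu] at hi
    obtain ⟨i₁, hi⟩ := List.append_inj hi (by rw [hlu₀, h₁.length_stepsInput hT₁, ha])
    obtain ⟨i₂, i₃⟩ := List.append_inj hi (by
      rw [hlu₁, h₂.length_stepsInput hT₁]; simp at hab; omega)
    rw [habc, pumpList_append ha hab, stepsInput_append, stepsInput_append,
      stepsInput_flatten_replicate, i₁, i₂, i₃]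
  have hloop : ∀ {i s s' f : Q'} {a b c : List (Transition A B Q')}, i ∈ T₂.initial →
      f ∈ T₂.final → T₂.IsPath i a s → T₂.IsPath s b s' → T₂.IsPath s' c f →
      stepsInput a = u₀ → stepsInput b = u₁ → stepsInput c = u₂ → s = s' := by
    intro i s s' f a b c hi hf ha hb hc hau hbu hcu
    let ρ : T₂.AcceptingRun := ⟨i, a ++ (b ++ c), f, hi,
      isPath_append.2 ⟨s, ha, isPath_append.2 ⟨s', hb, hc⟩⟩, hf⟩
    have h := hstates ρ (by
      rw [hu, ← hau, ← hbu, ← hcu, ← stepsInput_append, ← stepsInput_append]; rfl)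
    have hla : a.length = x := by rw [← ha.length_stepsInput hT₂, hau, hlu₀]
    have hlb : b.length = y - x := by rw [← hb.length_stepsInput hT₂, hbu, hlu₁]
    have e₁ : ρ.steps.take x = a := by
      change (a ++ (b ++ c)).take x = a
      rw [← hla, List.take_left]
    have e₂ : ρ.steps.take y = a ++ b := by
      change (a ++ (b ++ c)).take y = a ++ b
      rw [← List.append_assoc, ← show (a ++ b).length = y by simp; omega, List.take_left]
    rw [e₁, e₂] at h
    rwa [ha.endState_eq, (isPath_append.2 ⟨s, ha, hb⟩ : T₂.IsPath i (a ++ b) s').endState_eq] at h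
  have hunpump : ∀ ρ' : T₂.AcceptingRun, ρ'.input = r'.input →
      ∃ ρ : T₂.AcceptingRun, ρ.input = r.input ∧ ρ'.first = ρ.first ∧ ρ'.last = ρ.last ∧
        ρ'.steps = pumpList x y e ρ.steps := by
    intro ρ' hρ'
    obtain ⟨p, a, b, c, ha, hb, hc, hau, hbu, hcu, hsteps⟩ :=
      hm.exists_of_pumped hT₂ hacc hloop e ρ' (hρ'.trans hinput)
    refine ⟨⟨ρ'.first, a ++ (b ++ c), ρ'.last, ρ'.first_mem,
      isPath_append.2 ⟨p, ha, isPath_append.2 ⟨p, hb, hc⟩⟩, ρ'.last_mem⟩, ?_, rfl, rfl, ?_⟩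
    · rw [hu, ← hau, ← hbu, ← hcu, ← stepsInput_append, ← stepsInput_append]; rfl
    · have hla : a.length = x := by rw [← ha.length_stepsInput hT₂, hau, hlu₀]
      have hlb : b.length = y - x := by rw [← hb.length_stepsInput hT₂, hbu, hlu₁]
      rw [hsteps, pumpList_append hla (by simp; omega)]
  -- `φ` maps a run on the pumped input to the run from which it arises.
  choose! φ hφinput hφfirst hφlast hφsteps using hunpump
  have hφ : ∀ ρ' ∈ matchingRuns T₂ r', φ ρ' ∈ matchingRuns T₂ r ∧
      delayAt r.steps (φ ρ').steps y = delayAt r.steps (φ ρ').steps x := by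
    intro ρ' hρ'
    have hlen := hy.trans_eq (hlength _ (hφinput ρ' hρ'.1)).symm
    have hout : stepsOutput (pumpList x y e r.steps) ++ T₁.finalOut ⟨r.last, r.last_mem⟩ =
        stepsOutput (pumpList x y e (φ ρ').steps) ++
          T₂.finalOut ⟨(φ ρ').last, (φ ρ').last_mem⟩ := by
      have h := hρ'.2.symm
      simp only [AcceptingRun.output, hφsteps ρ' hρ'.1, hφlast ρ' hρ'.1] at h
      exact h
    have hd := he _ (hφinput ρ' hρ'.1) hout
    exact ⟨⟨hφinput ρ' hρ'.1, (output_eq_of_pump hxy _ _ hy hlen _ _ hd hout).symm⟩, hd⟩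
  refine ⟨r', fun ρ' hρ' => ?_, ?_⟩
  · obtain ⟨hmem, hd⟩ := hφ ρ' hρ'
    obtain ⟨j, hj, hk⟩ := hr _ hmem
    obtain ⟨j', hj', heq⟩ := exists_delayAt_pumpList_eq hxy r.steps (φ ρ').steps hy
      (hy.trans_eq (hlength _ hmem.1).symm) hd he₀ hj
    refine ⟨j', hj', ?_⟩
    rw [hφsteps ρ' hρ'.1]
    exact hk.trans_eq (congrArg FreeGroup.norm heq.symm)
  · calc (matchingRuns T₂ r').ncard ≤ (matchingRuns T₂ r \ {ρ₀}).ncard := by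
          refine Set.ncard_le_ncard_of_injOn φ (fun ρ' hρ' => ?_) (fun ρ' hρ' ρ'' hρ'' h => ?_)
            hfin'.sdiff
          · obtain ⟨hmem, hd⟩ := hφ ρ' hρ'
            refine ⟨hmem, fun h => hdelay ?_⟩
            rwa [← Set.mem_singleton_iff.1 h]
          · refine AcceptingRun.ext' ?_ ?_ ?_
            · rw [hφfirst _ hρ'.1, hφfirst _ hρ''.1, h]
            · rw [hφsteps _ hρ'.1, hφsteps _ hρ''.1, h]
            · rw [hφlast _ hρ'.1, hφlast _ hρ''.1, h]
      _ < (matchingRuns T₂ r).ncard := Set.ncard_sdiff_singleton_lt_of_mem hρ₀ hfin'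

end Transducer

/-! ### Positions with the same label and different delays -/

/-- A sequence that starts at `0` and grows by at most `D` in each step takes many values before it
becomes large. -/
theorem add_le_mul_card_image_range {f : ℕ → ℕ} {D j : ℕ} (h₀ : f 0 = 0)
    (hstep : ∀ i < j, f (i + 1) ≤ f i + D) :
    ∀ i ≤ j, f i + D ≤ D * ((Finset.range (j + 1)).image f).card := by
  induction j with
  | zero =>
    intro i hi
    obtain rfl : i = 0 := by omega
    simp [h₀]
  | succ j ih =>
    have ih := ih fun i hi => hstep i (by omega)
    have hmono : D * ((Finset.range (j + 1)).image f).card ≤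
        D * ((Finset.range (j + 1 + 1)).image f).card := by
      gcongr
      omega
    intro i hi
    rcases Nat.lt_or_eq_of_le hi with hi | rfl
    · exact (ih i (by omega)).trans hmono
    by_cases hmem : f (j + 1) ∈ (Finset.range (j + 1)).image f
    · obtain ⟨i, hi, hij⟩ := Finset.mem_image.1 hmem
      rw [← hij]
      exact (ih i (by simpa [Nat.lt_succ_iff] using hi)).trans hmono
    · rw [Finset.range_add_one, Finset.image_insert, Finset.card_insert_of_notMem hmem, mul_add,
        mul_one]
      have h₁ := hstep j (by omega)
      have h₂ := ih j le_rfl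
      omega

/-- If `f` starts at `0`, grows by at most `D` in each step and exceeds `D` times the number of
labels, two positions with the same label have different values of `f`. -/
theorem exists_lt_label_eq_and_ne {L : Type*} [Finite L] {f : ℕ → ℕ} {D j : ℕ} (g : ℕ → L)
    (h₀ : f 0 = 0) (hstep : ∀ i < j, f (i + 1) ≤ f i + D) (hj : D * Nat.card L < f j) :
    ∃ x y, x < y ∧ y ≤ j ∧ g x = g y ∧ f y ≠ f x := by
  classical
  have := Fintype.ofFinite L
  by_contra! hcon
  have hfg : ∀ x ≤ j, ∀ y ≤ j, g x = g y → f x = f y := by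
    intro x hx y hy hxy
    rcases lt_trichotomy x y with h | rfl | h
    · exact (hcon x y h hy hxy).symm
    · rfl
    · exact hcon y x h hx hxy.symm
  have hpre : ∀ v ∈ (Finset.range (j + 1)).image f, ∃ x ≤ j, f x = v := by
    intro v hv
    obtain ⟨x, hx, rfl⟩ := Finset.mem_image.1 hv
    exact ⟨x, by simpa [Nat.lt_succ_iff] using hx, rfl⟩
  choose! s hs hfs using hpre
  have hcard : ((Finset.range (j + 1)).image f).card ≤ Nat.card L := by
    rw [Nat.card_eq_fintype_card, ← Finset.card_univ]
    refine Finset.card_le_card_of_injOn (fun v => g (s v))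
      (fun _ _ => Finset.mem_coe.2 (Finset.mem_univ _)) ?_
    intro v hv w hw hvw
    rw [← hfs v hv, ← hfs w hw]
    exact hfg _ (hs v hv) _ (hs w hw) hvw
  have h₁ := add_le_mul_card_image_range h₀ hstep j le_rfl
  have h₂ := Nat.mul_le_mul_left D hcard
  omega

namespace Transducer

variable {A B Q Q' : Type*}

theorem length_out_le_maxOutputLength (T : Transducer A B Q) {t : Transition A B Q}
    (ht : t ∈ T.trans) : t.out.length ≤ T.maxOutputLength :=
  (Finset.le_sup (f := fun t : Transition A B Q => t.out.length) ht).trans (le_max_left _ _)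

theorem norm_delayAt_succ_le [DecidableEq B] {T₁ : Transducer A B Q} {T₂ : Transducer A B Q'}
    {l : List (Transition A B Q)} {l' : List (Transition A B Q')} (hl : ∀ t ∈ l, t ∈ T₁.trans)
    (hl' : ∀ t ∈ l', t ∈ T₂.trans) {j : ℕ} (hj : j < l.length) (hj' : j < l'.length) :
    (delayAt l l' (j + 1)).norm ≤
      (delayAt l l' j).norm + 2 * max T₁.maxOutputLength T₂.maxOutputLength := by
  rw [delayAt, ← List.take_append_getElem hj, ← List.take_append_getElem hj',
    stepsOutput_append, stepsOutput_append]
  refine (norm_delay_append_le _ _ _ _).trans (Nat.add_le_add_left ?_ _)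
  have h₁ := T₁.length_out_le_maxOutputLength (hl _ (List.getElem_mem hj))
  have h₂ := T₂.length_out_le_maxOutputLength (hl' _ (List.getElem_mem hj'))
  simp only [stepsOutput, List.flatMap_cons, List.flatMap_nil, List.append_nil]
  omega

/-- A matching run of `T₂` with a large delay has two positions at which all states and accepting
states agree and the delays differ. -/
theorem exists_pumpable_positions [DecidableEq B] [Fintype Q] [Fintype Q']
    {T₁ : Transducer A B Q} {T₂ : Transducer A B Q'} {m : ℕ} (hT₁ : T₁.IsRealTime)
    (hT₂ : T₂.IsRealTime) (hm : T₂.IsAmbiguousLE m) {r : T₁.AcceptingRun} {ρ₀ : T₂.AcceptingRun}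
    (hρ₀ : ρ₀.input = r.input) {j : ℕ} (hj : j < r.steps.length)
    (hk : 2 * max T₁.maxOutputLength T₂.maxOutputLength *
      (Fintype.card Q * (Fintype.card Q' ^ m * 2 ^ Fintype.card Q')) <
        (delayAt r.steps ρ₀.steps j).norm) :
    ∃ x y, x ≤ y ∧ y ≤ r.steps.length ∧
      endState r.first (r.steps.take x) = endState r.first (r.steps.take y) ∧
      (∀ ρ : T₂.AcceptingRun, ρ.input = r.input →
        endState ρ.first (ρ.steps.take x) = endState ρ.first (ρ.steps.take y)) ∧
      (∀ q, T₂.Accepts q (r.input.drop x) ↔ T₂.Accepts q (r.input.drop y)) ∧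
      delayAt r.steps ρ₀.steps y ≠ delayAt r.steps ρ₀.steps x := by
  have hlen : ρ₀.steps.length = r.steps.length := by
    rw [← ρ₀.length_input hT₂, hρ₀, r.length_input hT₁]
  have hfin : {ρ : T₂.AcceptingRun | ρ.input = r.input}.Finite :=
    Set.finite_of_encard_le_coe (hm r.input)
  have := hfin.to_subtype
  -- The labels of the positions.
  let L := Q × ({ρ : T₂.AcceptingRun | ρ.input = r.input} → Q') × Set Q'
  let g : ℕ → L := fun i => (endState r.first (r.steps.take i),
    fun ρ => endState ρ.1.first (ρ.1.steps.take i), {q | T₂.Accepts q (r.input.drop i)})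
  have hcard : Nat.card L ≤ Fintype.card Q * (Fintype.card Q' ^ m * 2 ^ Fintype.card Q') := by
    have hpos : 0 < Fintype.card Q' := Fintype.card_pos_iff.2 ⟨ρ₀.first⟩
    have hle : Nat.card {ρ : T₂.AcceptingRun | ρ.input = r.input} ≤ m := by
      have h := hm r.input
      rw [← hfin.cast_ncard_eq] at h
      exact Nat.cast_le.1 h
    rw [Nat.card_prod, Nat.card_prod, Nat.card_fun, Nat.card_eq_fintype_card (α := Set Q'),
      Nat.card_eq_fintype_card (α := Q), Nat.card_eq_fintype_card (α := Q'), Fintype.card_set]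
    gcongr
  obtain ⟨x, y, hxy, hyj, hg, hne⟩ := exists_lt_label_eq_and_ne
    (f := fun i => (delayAt r.steps ρ₀.steps i).norm) (j := j) g (by simp [delayAt])
    (fun i hi => norm_delayAt_succ_le r.isPath.mem_trans ρ₀.isPath.mem_trans
      (hi.trans hj) ((hi.trans hj).trans_eq hlen.symm))
    ((Nat.mul_le_mul_left _ hcard).trans_lt hk)
  refine ⟨x, y, hxy.le, by omega, congrArg Prod.fst hg, fun ρ hρ => ?_, fun q => ?_,
    fun h => hne (congrArg FreeGroup.norm h)⟩
  · exact congrFun (congrArg (fun z : L => z.2.1) hg) ⟨ρ, hρ⟩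
  · exact Set.ext_iff.1 (congrArg (fun z : L => z.2.2) hg) q

theorem Included.exists_mem_matchingRuns {T₁ : Transducer A B Q} {T₂ : Transducer A B Q'}
    (h : T₁.Included T₂) (r : T₁.AcceptingRun) : (matchingRuns T₂ r).Nonempty := by
  obtain ⟨_, ⟨ρ, rfl⟩, hρ⟩ := h ⟨r.word, ⟨r, rfl⟩, rfl⟩
  obtain ⟨h₁, h₂⟩ := Prod.ext_iff.1 hρ
  simp only [AcceptingRun.inputProj_word, AcceptingRun.outputProj_word] at h₁ h₂
  exact ⟨ρ, h₁.symm, h₂.symm⟩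

/-- There are no lagging runs: pumping would give lagging runs matched by ever fewer runs of `T₂`.
If `T₂` has no transitions, its runs are too short to lag, whence the restriction in `hk`. -/
theorem Included.not_isLagging [DecidableEq B] [Fintype Q] [Fintype Q']
    {T₁ : Transducer A B Q} {T₂ : Transducer A B Q'} {m k : ℕ} (hincl : T₁.Included T₂)
    (hT₁ : T₁.IsRealTime) (hT₂ : T₂.IsRealTime) (hm : T₂.IsAmbiguousLE m)
    (hk : T₂.trans.Nonempty → 2 * max T₁.maxOutputLength T₂.maxOutputLength *
      (Fintype.card Q * (Fintype.card Q' ^ m * 2 ^ Fintype.card Q')) ≤ k)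
    (r : T₁.AcceptingRun) : ¬ IsLagging T₂ k r := by
  induction hn : (matchingRuns T₂ r).ncard using Nat.strong_induction_on generalizing r with
  | _ n ih =>
    intro hr
    obtain ⟨ρ₀, hρ₀⟩ := hincl.exists_mem_matchingRuns r
    obtain ⟨j, hj, hkj⟩ := hr ρ₀ hρ₀
    have hne : T₂.trans.Nonempty := by
      have hlen : ρ₀.steps.length = r.steps.length := by
        rw [← ρ₀.length_input hT₂, hρ₀.1, r.length_input hT₁]
      exact ⟨_, ρ₀.isPath.mem_trans _ (List.getElem_mem (hj.trans_eq hlen.symm))⟩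
    obtain ⟨x, y, hxy, hy, hstate, hstates, hacc, hdelay⟩ :=
      exists_pumpable_positions hT₁ hT₂ hm hρ₀.1 hj ((hk hne).trans_lt hkj)
    obtain ⟨r', hr', hlt⟩ :=
      hr.exists_ncard_lt hT₁ hT₂ hm hρ₀ hxy hy hstate hstates hacc hdelay
    exact ih _ (hn ▸ hlt) r' rfl hr'

end Transducer

theorem mainTheorem1 {A B Q₁ Q₂ : Type*} [Finite A] [Finite B] [DecidableEq B]
    [Fintype Q₁] [Fintype Q₂]
    (T₁ : Transducer A B Q₁) (T₂ : Transducer A B Q₂) (m : ℕ)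
    (hT₁ : T₁.IsRealTime) (hT₂ : T₂.IsRealTime)
    (hm : T₂.IsAmbiguousLE m)
    (hincl : T₁.Included T₂) :
    Transducer.KIncluded
      (4 * max T₁.maxOutputLength T₂.maxOutputLength * Fintype.card Q₁ *
        ((T₂.trans.card * Fintype.card Q₂) ^ m * 2 ^ (Fintype.card Q₂ * T₂.trans.card) + 1))
      T₁ T₂ := by
  -- The pumping argument yields a smaller bound, provided that `T₂` has a transition.
  have hk : T₂.trans.Nonempty → 2 * max T₁.maxOutputLength T₂.maxOutputLength *
      (Fintype.card Q₁ * (Fintype.card Q₂ ^ m * 2 ^ Fintype.card Q₂)) ≤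
      4 * max T₁.maxOutputLength T₂.maxOutputLength * Fintype.card Q₁ *
        ((T₂.trans.card * Fintype.card Q₂) ^ m * 2 ^ (Fintype.card Q₂ * T₂.trans.card) + 1) := by
    intro hne
    have hpos : 0 < T₂.trans.card := hne.card_pos
    have h : Fintype.card Q₂ ^ m * 2 ^ Fintype.card Q₂ ≤
        (T₂.trans.card * Fintype.card Q₂) ^ m * 2 ^ (Fintype.card Q₂ * T₂.trans.card) := by
      gcongr
      · exact Nat.le_mul_of_pos_left _ hpos
      · norm_num
      · exact Nat.le_mul_of_pos_right _ hpos
    rw [← mul_assoc]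
    exact Nat.mul_le_mul (Nat.mul_le_mul_right _ (Nat.mul_le_mul_right _ (by norm_num)))
      (h.trans (Nat.le_succ _))
  rintro _ ⟨r, rfl⟩
  have hr := hincl.not_isLagging hT₁ hT₂ hm hk r
  simp only [Transducer.IsLagging, not_forall, not_exists, not_and, not_lt] at hr
  obtain ⟨ρ, hρ, hle⟩ := hr
  have hin : inputProj r.word = inputProj ρ.word := by
    rw [r.inputProj_word, ρ.inputProj_word, hρ.1]
  have hout : outputProj r.word = outputProj ρ.word := by
    rw [r.outputProj_word, ρ.outputProj_word, hρ.2]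
  refine ⟨_, ⟨ρ, rfl⟩, ⟨hin, hout⟩, Finset.sup_le fun j hj => ?_⟩
  have hlen : ρ.steps.length = r.steps.length := by
    rw [← ρ.length_input hT₂, hρ.1, r.length_input hT₁]
  rcases Nat.lt_or_eq_of_le (Nat.lt_succ_iff.1 (Finset.mem_range.1 hj)) with hj | rfl
  · rw [r.inputProj_word, r.length_input hT₁] at hj
    rw [r.outputUpTo_word hT₁ hj, ρ.outputUpTo_word hT₂ (hj.trans_eq hlen.symm)]
    exact hle j hj
  · -- After the last input letter both words have produced their whole output.
    rw [outputUpTo_length_inputProj, hin, outputUpTo_length_inputProj, hout, delay_self,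
      FreeGroup.norm_one]
    exact Nat.zero_le _
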